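/- Let $\mathbb T^2=\mathbb R^2/\mathbb Z^2$, with Lebesgue probability measure $\mathrm{vol}$, let $T^*\mathbb T^2=\mathbb T^2\times\mathbb R^2$ with projection $\Pi(x,\xi)=x$, and let $V\in C^\infty(\mathbb T^2;\mathbb R)$. Let $\Lambda\subset\mathbb Z^2$ be a primitive sublattice of rank $1$ (its real span $\langle\Lambda\rangle$ is a line and $\langle\Lambda\rangle\cap\mathbb Z^2=\Lambda$), let $\mathfrak e_\Lambda$ be a generator of $\Lambda$, let $L_\Lambda=\|\mathfrak e_\Lambda\|$, and let $\mathfrak e_\Lambda^\perp$ be the vector of the same length that is directly orthogonal to $\mathfrak e_\Lambda$. Put $$H_\Lambda(x,\xi)=\tfrac1{L_\Lambda}\langle\xi,\mathfrak e_\Lambda\rangle,\qquad H_\Lambda^\perp(x,\xi)=\tfrac1{L_\Lambda}\langle\xi,\mathfrak e_\Lambda^\perp\rangle,$$ $$\mathcal I_\Lambda(V)(x)=\tfrac1{L_\Lambda}\int_0^{L_\Lambda}V\Big(x+s\tfrac{\mathfrak e_\Lambda^\perp}{L_\Lambda}\Big)\,ds,\qquad p_\Lambda(x,\xi)=\tfrac12H_\Lambda(x,\xi)^2+\mathcal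 I_\Lambda(V)(x),$$ let $\varphi^t_{H_\Lambda^\perp}$ and $\varphi^t_{p_\Lambda}$ be the Hamiltonian flows of $H_\Lambda^\perp$ and $p_\Lambda$ on $T^*\mathbb T^2$, and put $$\mathrm{Crit}_\Lambda(V)=\{(x,\xi)\in T^*\mathbb T^2:\ H_\Lambda(x,\xi)=0\ \text{and}\ \partial_x\mathcal I_\Lambda(V)(x)=0\}.$$ For an orbit $\Gamma$ of $\varphi_{H_\Lambda^\perp}$ let $\delta_{\Pi\circ\Gamma}$ be the uniform probability measure (normalized length measure) on the closed geodesic $\Pi(\Gamma)$, and let $\mathcal N(\Lambda)$ be the closed convex hull, for the weak topology of finite measures on $\mathbb T^2$, of the measures $\delta_{\Pi\circ\Gamma}$ where $\Gamma$ ranges over the orbits of $\varphi_{H_\Lambda^\perp}$ contained in $\mathrm{Crit}_\Lambda(V)$. Let $\mu$ be a (Borel) probability measure on $T^*\mathbb T^2$ that is invariant under $\varphi^t_{H_\Lambda^\perp}$ and $\varphi^t_{p_\Lambda}$ for all $t\in\mathbb R$. Then there are a nonnegative $f\in L^1(\mathbb T^2,\mathrm{vol})$, a number $\alpha\in[0,1]$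 and a measure $\nu_{\mathrm{sing}}\in\mathcal N(\Lambda)$ such that $$\Pi_*\mu=f\,\mathrm{vol}+\alpha\,\nu_{\mathrm{sing}}.$$ -/

import Mathlib

open MeasureTheory Set Filter Topology
open scoped NNReal ContDiff RealInnerProductSpace

noncomputable section

namespace TorusBiinv

/-- The Euclidean plane `ℝ²`. -/
abbrev Plane : Type := EuclideanSpace ℝ (Fin 2)

/-- The rational torus `𝕋² = ℝ² / ℤ²`, with its Lebesgue (Haar) probability measure `volume`. -/
abbrev Torus : Type := Fin 2 → UnitAddCircle

/-- The cotangent bundle `T*𝕋² = 𝕋² × ℝ²`; its points are written `(x, ξ)`. -/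
abbrev Phase : Type := Torus × Plane

/-- The canonical projection `ℝ² → 𝕋²`. -/
def proj (v : Plane) : Torus := fun i => (v i : UnitAddCircle)

/-- `V : 𝕋² → ℝ` is smooth: its lift to a `ℤ²`-periodic function on `ℝ²` is smooth. -/
def SmoothOnTorus (V : Torus → ℝ) : Prop :=
  ContDiff ℝ ∞ (fun v : Plane => V (proj v))

/-- The gradient `∂ₓ g (x)` of a function `g` on the torus, for the flat metric. -/
def torusGrad (g : Torus → ℝ) (x : Torus) : Plane :=
  gradient (fun v : Plane => g (x + proj v)) 0

/-! ### Hamiltonian flows on `T*𝕋²` -/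

/-- The Hamiltonian vector field `(∂_ξ h, -∂ₓ h)` of `h` for the canonical symplectic form. -/
def hamField (h : Phase → ℝ) (z : Phase) : Plane × Plane :=
  (gradient (fun ξ : Plane => h (z.1, ξ)) z.2, -torusGrad (fun x => h (x, z.2)) z.1)

/-- `φ` is the (complete) flow of the vector field `X` on `T*𝕋²`: each curve `t ↦ φ t (x, ξ)` starts
at `(x, ξ)` and solves the differential equation of `X`. The curve `c` below is its lift to
`ℝ² × ℝ²`, with first component taken relative to the starting point. -/
def IsFlow (X : Phase → Plane × Plane) (φ : ℝ → Phase → Phase) : Prop :=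
  ∀ z : Phase, ∃ c : ℝ → Plane × Plane, c 0 = (0, z.2) ∧
    ∀ t : ℝ, φ t z = (z.1 + proj (c t).1, (c t).2) ∧ HasDerivAt c (X (φ t z)) t

open Classical in
/-- The Hamiltonian flow `φ_h^t` of `h` (the identity if `h` has no complete flow). -/
def hamFlow (h : Phase → ℝ) : ℝ → Phase → Phase :=
  if H : ∃ φ, IsFlow (hamField h) φ then H.choose else fun _ z => z

/-! ### Primitive lattices of rank one and the associated Hamiltonians -/

/-- The inclusion `ℤ² → ℝ²`. -/
def latVec (k : Fin 2 → ℤ) : Plane := !₂[(k 0 : ℝ), (k 1 : ℝ)]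

/-- `Λ` is a primitive sublattice of `ℤ²` of rank one: its real span `⟨Λ⟩` is a line, and
`⟨Λ⟩ ∩ ℤ² = Λ`. -/
def IsPrimitiveRankOne (Λ : AddSubgroup (Fin 2 → ℤ)) : Prop :=
  Module.finrank ℝ (Submodule.span ℝ (latVec '' (Λ : Set (Fin 2 → ℤ)))) = 1 ∧
    ∀ k : Fin 2 → ℤ, latVec k ∈ Submodule.span ℝ (latVec '' (Λ : Set (Fin 2 → ℤ))) → k ∈ Λ

/-- The vector `𝔢^⊥`, of the same length as `𝔢` and directly orthogonal to it. -/
def latPerp (e : Fin 2 → ℤ) : Plane := !₂[-(e 1 : ℝ), (e 0 : ℝ)]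

/-- The length `L_Λ = ‖𝔢_Λ‖`. -/
def latLen (e : Fin 2 → ℤ) : ℝ := ‖latVec e‖

/-- `H_Λ(x, ξ) = ⟨ξ, 𝔢_Λ⟩ / L_Λ`. -/
def HLam (e : Fin 2 → ℤ) (z : Phase) : ℝ := (1 / latLen e) * ⟪z.2, latVec e⟫

/-- `H_Λ^⊥(x, ξ) = ⟨ξ, 𝔢_Λ^⊥⟩ / L_Λ`. -/
def HPerp (e : Fin 2 → ℤ) (z : Phase) : ℝ := (1 / latLen e) * ⟪z.2, latPerp e⟫

/-- The average `I_Λ(V)(x)` of `V` along the closed geodesic through `x` directed by `𝔢_Λ^⊥`. -/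
def avg (e : Fin 2 → ℤ) (V : Torus → ℝ) (x : Torus) : ℝ :=
  (1 / latLen e) * ∫ s in (0 : ℝ)..latLen e, V (x + proj ((s / latLen e) • latPerp e))

/-- `p_Λ = H_Λ² / 2 + I_Λ(V)`, as a function on `T*𝕋²`. -/
def pLam (e : Fin 2 → ℤ) (V : Torus → ℝ) (z : Phase) : ℝ :=
  HLam e z ^ 2 / 2 + avg e V z.1

/-- The critical set `Crit_Λ(V)`. -/
def Crit (e : Fin 2 → ℤ) (V : Torus → ℝ) : Set Phase :=
  {z | HLam e z = 0 ∧ torusGrad (avg e V) z.1 = 0}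

/-! ### Uniform measures on projected orbits -/

/-- The uniform probability measure `δ_{Π∘Γ}` on the projection to `𝕋²` of the orbit `Γ` of `z` under
the flow of `H_Λ^⊥`. This closed geodesic is traversed at unit speed and has length `L_Λ`, so the
measure is the image of the normalized Lebesgue measure on `(0, L_Λ]`. -/
def orbitMeasure (e : Fin 2 → ℤ) (z : Phase) : Measure Torus :=
  (ENNReal.ofReal (latLen e))⁻¹ •
    (volume.restrict (Ioc 0 (latLen e))).map (fun s : ℝ => (hamFlow (HPerp e) s z).1)

/-- The set `𝒩(Λ)`: the closed convex hull, for the weak topology of finite measures on `𝕋²`, of the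
measures `δ_{Π∘Γ}`, where `Γ` ranges over the orbits of `H_Λ^⊥` contained in `Crit_Λ(V)`. -/
def NLam (e : Fin 2 → ℤ) (V : Torus → ℝ) : Set (FiniteMeasure Torus) :=
  closure (convexHull ℝ≥0
    {m : FiniteMeasure Torus | ∃ z : Phase, (∀ s : ℝ, hamFlow (HPerp e) s z ∈ Crit e V) ∧
      (m : Measure Torus) = orbitMeasure e z})

/-! ### Completeness: the flows of `H_Λ^⊥` and of `p_Λ` exist for all times -/

theorem hasFDerivAt_lineAvg {F : Type*} [NormedAddCommGroup F] [NormedSpace ℝ F]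
    [CompleteSpace F] {g : Plane → F} (hg : ContDiff ℝ 1 g) (u : Plane) (L : ℝ) (v : Plane) :
    HasFDerivAt (fun v : Plane => ∫ s in (0 : ℝ)..L, g (v + s • u))
      (∫ s in (0 : ℝ)..L, fderiv ℝ g (v + s • u)) v := by
  have hgc : Continuous g := hg.continuous
  have hg' : Continuous (fderiv ℝ g) := hg.continuous_fderiv one_ne_zero
  have hK : IsCompact (Metric.closedBall v 1 ×ˢ uIcc (0 : ℝ) L) :=
    (isCompact_closedBall v 1).prod isCompact_uIcc
  obtain ⟨C, hC⟩ := hK.exists_bound_of_continuousOn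
    (f := fun q : Plane × ℝ => fderiv ℝ g (q.1 + q.2 • u)) (by fun_prop)
  refine intervalIntegral.hasFDerivAt_integral_of_dominated_of_fderiv_le
    (F' := fun v s => fderiv ℝ g (v + s • u)) (bound := fun _ => C)
    (Metric.closedBall_mem_nhds v one_pos) ?_ ?_ ?_ ?_ ?_ ?_
  · exact Eventually.of_forall fun x => (by fun_prop : Continuous _).aestronglyMeasurable
  · exact (by fun_prop : Continuous _).intervalIntegrable _ _
  · have hc : Continuous fun s : ℝ => fderiv ℝ g (v + s • u) := by fun_prop
    exact hc.aestronglyMeasurable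
  · exact Eventually.of_forall fun t ht x hx => hC (x, t) ⟨hx, uIoc_subset_uIcc ht⟩
  · exact intervalIntegrable_const
  · refine Eventually.of_forall fun t ht x hx => ?_
    have h := (hg.differentiable one_ne_zero (x + t • u)).hasFDerivAt
    have h' := HasFDerivAt.comp x h ((hasFDerivAt_id x).add_const (t • u))
    rwa [ContinuousLinearMap.comp_id] at h'

theorem contDiff_lineAvg (n : ℕ) : ∀ {F : Type} [NormedAddCommGroup F] [NormedSpace ℝ F]
    [CompleteSpace F] {g : Plane → F}, ContDiff ℝ n g → ∀ (u : Plane) (L : ℝ),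
    ContDiff ℝ n (fun v : Plane => ∫ s in (0 : ℝ)..L, g (v + s • u)) := by
  induction n with
  | zero =>
    intro F _ _ _ g hg u L
    rw [Nat.cast_zero, contDiff_zero] at *
    exact intervalIntegral.continuous_parametric_intervalIntegral_of_continuous'
      (by simp only [Function.uncurry_def]; fun_prop) _ _
  | succ n ih =>
    intro F _ _ _ g hg u L
    rw [Nat.cast_succ] at *
    rw [contDiff_succ_iff_hasFDerivAt]
    exact ⟨_, ih (hg.fderiv_right le_rfl) u L,
      fun v => hasFDerivAt_lineAvg (hg.of_le (by norm_cast; omega)) u L v⟩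

theorem proj_add (v w : Plane) : proj (v + w) = proj v + proj w := by
  ext i; simp [proj]

theorem proj_surjective : Function.Surjective proj := by
  intro x
  choose v hv using fun i => QuotientAddGroup.mk_surjective (x i)
  exact ⟨WithLp.toLp 2 v, funext hv⟩

theorem contDiff_avg {V : Torus → ℝ} (hV : SmoothOnTorus V) (e : Fin 2 → ℤ) :
    ContDiff ℝ 2 (fun v : Plane => avg e V (proj v)) := by
  have h := (contDiff_lineAvg 2 (contDiff_infty.1 hV 2)
    ((1 / latLen e) • latPerp e) (latLen e)).const_smul (1 / latLen e)
  refine Eq.mp (congrArg _ (funext fun v => ?_)) h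
  simp only [avg, smul_eq_mul, ← proj_add, smul_smul, mul_one_div]

theorem torusGrad_proj (g : Torus → ℝ) (w : Plane) :
    torusGrad g (proj w) = gradient (fun v : Plane => g (proj v)) w := by
  simp only [torusGrad, gradient, ← proj_add]
  rw [fderiv_comp_add_left (f := fun v : Plane => g (proj v)) w, add_zero]

theorem contDiff_torusGrad_proj {V : Torus → ℝ} (hV : SmoothOnTorus V) (e : Fin 2 → ℤ) :
    ContDiff ℝ 1 (fun w : Plane => torusGrad (avg e V) (proj w)) := by
  simp only [torusGrad_proj, gradient]
  exact (InnerProductSpace.toDual ℝ Plane).symm.contDiff.comp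
    ((contDiff_avg hV e).fderiv_right (m := 1) (by norm_num))

theorem exists_bound_torusGrad {V : Torus → ℝ} (hV : SmoothOnTorus V) (e : Fin 2 → ℤ) :
    ∃ M : ℝ, ∀ x, ‖torusGrad (avg e V) x‖ ≤ M := by
  obtain ⟨M, hM⟩ := (isCompact_closedBall (0 : Plane) 2).exists_bound_of_continuousOn
    (contDiff_torusGrad_proj hV e).continuous.continuousOn
  refine ⟨M, fun x => ?_⟩
  obtain ⟨w, rfl⟩ := proj_surjective x
  have : proj w = proj (WithLp.toLp 2 fun i => Int.fract (w i)) := by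
    ext i
    simp only [proj, Int.fract]
    have hz : ((⌊w i⌋ : ℝ) : UnitAddCircle) = 0 :=
      (AddCircle.coe_eq_zero_iff (1 : ℝ)).2 ⟨⌊w i⌋, by simp⟩
    rw [AddCircle.coe_sub, hz, sub_zero]
  rw [this]
  refine hM _ ?_
  rw [mem_closedBall_zero_iff, EuclideanSpace.norm_eq, Fin.sum_univ_two]
  refine Real.sqrt_le_iff.2 ⟨by norm_num, ?_⟩
  have h0 := Int.fract_nonneg (w 0)
  have h1 := Int.fract_nonneg (w 1)
  have h2 := (Int.fract_lt_one (w 0)).le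
  have h3 := (Int.fract_lt_one (w 1)).le
  simp only [Real.norm_eq_abs, sq_abs]
  nlinarith

theorem hasFDerivAt_inner_right (u ξ : Plane) :
    HasFDerivAt (fun ξ : Plane => ⟪ξ, u⟫) (innerSL ℝ u) ξ := by
  have h : (fun ξ : Plane => ⟪ξ, u⟫) = innerSL ℝ u := funext fun ξ => real_inner_comm _ _
  rw [h]
  exact (innerSL ℝ u).hasFDerivAt

theorem hamField_HPerp (e : Fin 2 → ℤ) (z : Phase) :
    hamField (HPerp e) z = ((1 / latLen e) • latPerp e, 0) := by
  have h : HasGradientAt (fun ξ : Plane => (1 / latLen e) * ⟪ξ, latPerp e⟫)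
      ((1 / latLen e) • latPerp e) z.2 := by
    rw [hasGradientAt_iff_hasFDerivAt]
    refine ((hasFDerivAt_inner_right (latPerp e) z.2).const_mul (1 / latLen e)).congr_fderiv ?_
    ext ξ
    simp
  have h2 : torusGrad (fun x : Torus => HPerp e (x, z.2)) z.1 = 0 := by
    simp [torusGrad, HPerp, gradient]
  simp only [hamField, h2, neg_zero]
  simp only [HPerp]
  rw [h.gradient]

theorem hamField_pLam (e : Fin 2 → ℤ) (V : Torus → ℝ) (z : Phase) :
    hamField (pLam e V) z =
      ((HLam e z / latLen e) • latVec e, -torusGrad (avg e V) z.1) := by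
  have h : HasGradientAt (fun ξ : Plane => ((1 / latLen e) * ⟪ξ, latVec e⟫) ^ 2 / 2 + avg e V z.1)
      ((HLam e z / latLen e) • latVec e) z.2 := by
    rw [hasGradientAt_iff_hasFDerivAt]
    refine (((((hasFDerivAt_inner_right (latVec e) z.2).const_mul (1 / latLen e)).pow 2).mul_const
      (2⁻¹ : ℝ)).add_const (avg e V z.1)).congr_fderiv ?_
    ext ξ
    simp [HLam]
    ring
  have h2 : torusGrad (fun x : Torus => pLam e V (x, z.2)) z.1 = torusGrad (avg e V) z.1 := by
    simp only [torusGrad, pLam, HLam, gradient]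
    rw [fderiv_const_add]
  simp only [hamField, h2]
  simp only [pLam, HLam]
  rw [h.gradient]
  rfl

theorem exists_isFlow_HPerp (e : Fin 2 → ℤ) : ∃ φ, IsFlow (hamField (HPerp e)) φ := by
  refine ⟨fun t z => (z.1 + proj (t • ((1 / latLen e) • latPerp e)), z.2), fun z =>
    ⟨fun t => (t • ((1 / latLen e) • latPerp e), z.2), by simp, fun t => ⟨rfl, ?_⟩⟩⟩
  rw [hamField_HPerp]
  have h := (hasDerivAt_id t).smul_const ((1 / latLen e) • latPerp e)
  rw [one_smul] at h
  exact h.prodMk (hasDerivAt_const t z.2)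

open scoped Manifold in
/-- A `C¹` vector field whose integral curves all live for a common time is complete. -/
theorem exists_curve {E : Type*} [NormedAddCommGroup E] [NormedSpace ℝ E] [CompleteSpace E]
    {F : E → E} (hF : ContDiff ℝ 1 F) {ε : ℝ} (hε : 0 < ε)
    (h : ∀ x, ∃ γ : ℝ → E, γ 0 = x ∧ ∀ t ∈ Ioo (-ε) ε, HasDerivAt γ (F (γ t)) t) (x : E) :
    ∃ γ : ℝ → E, γ 0 = x ∧ ∀ t, HasDerivAt γ (F (γ t)) t := by
  obtain ⟨γ, h0, hγ⟩ := exists_isMIntegralCurve_of_isMIntegralCurveOn (I := 𝓘(ℝ, E)) (M := E)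
    (v := F) (contMDiff_vectorSpace_iff_contDiff.2 hF) hε (fun x => by
      obtain ⟨γ, h0, hγ⟩ := h x
      exact ⟨γ, h0, fun t ht => ((hγ t ht).hasFDerivAt.hasMFDerivAt).hasMFDerivWithinAt⟩) x
  exact ⟨γ, h0, fun t => (hasDerivAt_iff_hasFDerivAt.2 (hγ t).hasFDerivAt)⟩

theorem exists_isFlow_pLam {V : Torus → ℝ} (hV : SmoothOnTorus V) (e : Fin 2 → ℤ) :
    ∃ φ, IsFlow (hamField (pLam e V)) φ := by
  obtain ⟨M, hM⟩ := exists_bound_torusGrad hV e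
  have hM0 : 0 ≤ M := (norm_nonneg _).trans (hM 0)
  suffices H : ∀ z : Phase, ∃ c : ℝ → Plane × Plane, c 0 = (0, z.2) ∧ ∀ t,
      HasDerivAt c (hamField (pLam e V) (z.1 + proj (c t).1, (c t).2)) t by
    choose c h0 hc using H
    exact ⟨fun t z => (z.1 + proj (c z t).1, (c z t).2), fun z => ⟨c z, h0 z, fun t =>
      ⟨rfl, hc z t⟩⟩⟩
  rintro ⟨x, ξ⟩
  obtain ⟨w, rfl⟩ := proj_surjective x
  let F : Plane × Plane → Plane × Plane := fun q => hamField (pLam e V) (proj w + proj q.1, q.2)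
  have hF : ∀ q, F q = (((1 / latLen e) * ⟪q.2, latVec e⟫ / latLen e) • latVec e,
      -torusGrad (avg e V) (proj (w + q.1))) := fun q => by
    simp only [F, hamField_pLam, proj_add, HLam]
  have hFc : ContDiff ℝ 1 F := by
    rw [funext hF]
    have := contDiff_torusGrad_proj hV e
    exact ContDiff.prodMk
      ((((contDiff_snd.inner ℝ contDiff_const).const_smul (1 / latLen e)).div_const _).smul
        contDiff_const) ((this.comp (by fun_prop :
      ContDiff ℝ 1 fun q : Plane × Plane => w + q.1)).neg)
  have hb : ∀ q, ‖F q‖ ≤ ‖q‖ + M := fun q => by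
    rw [hF, Prod.norm_def]
    refine max_le ?_ ?_
    · have h1 : ‖q.2‖ ≤ ‖q‖ := norm_snd_le q
      have h2 : ‖((1 / latLen e) * ⟪q.2, latVec e⟫ / latLen e) • latVec e‖ ≤ ‖q.2‖ := by
        rcases (norm_nonneg (latVec e)).eq_or_lt with h | h
        · rw [norm_smul, ← h, mul_zero]; exact norm_nonneg _
        · have h3 := abs_real_inner_le_norm q.2 (latVec e)
          rw [norm_smul, norm_div, norm_mul, norm_div]
          simp only [latLen, norm_norm, norm_one, Real.norm_eq_abs (inner ℝ _ _)]
          field_simp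
          nlinarith
      exact (h2.trans h1).trans (by linarith)
    · rw [norm_neg]
      exact (hM _).trans (by linarith [norm_nonneg q])
  refine exists_curve hFc (ε := 1 / 2) (by norm_num) (fun q => ?_) (0, ξ)
  have ha : 0 ≤ ‖q‖ + M := by positivity
  obtain ⟨K, hK⟩ := LocallyLipschitzOn.exists_lipschitzOnWith_of_compact
    (isCompact_closedBall q (‖q‖ + M)) (hFc.locallyLipschitz.locallyLipschitzOn (s := _))
  have hPL : IsPicardLindelof (fun _ => F) (tmin := -(1 / 2)) (tmax := 1 / 2)
      ⟨0, by norm_num⟩ q ⟨‖q‖ + M, ha⟩ 0 ⟨2 * (‖q‖ + M), by positivity⟩ K := by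
    refine IsPicardLindelof.of_time_independent (fun y hy => ?_) hK ?_
    · have h1 : ‖y‖ ≤ ‖q‖ + (‖q‖ + M) := by
        have := norm_le_norm_add_norm_sub' y q
        have h2 : ‖y - q‖ ≤ ‖q‖ + M := mem_closedBall_iff_norm.1 hy
        linarith
      refine (hb y).trans ?_
      change _ ≤ 2 * (‖q‖ + M)
      linarith
    · change 2 * (‖q‖ + M) * _ ≤ ‖q‖ + M - 0
      norm_num
      linarith
  obtain ⟨γ, h0, hγ⟩ := hPL.exists_eq_forall_mem_Icc_hasDerivWithinAt₀
  exact ⟨γ, h0, fun t ht =>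
    (hγ t (Ioo_subset_Icc_self ht)).hasDerivAt (Icc_mem_nhds ht.1 ht.2)⟩

/-- `hamFlow (pLam e V)` is the Hamiltonian flow of `p_Λ`. -/
theorem isFlow_hamFlow_pLam {V : Torus → ℝ} (hV : SmoothOnTorus V) (e : Fin 2 → ℤ) :
    IsFlow (hamField (pLam e V)) (hamFlow (pLam e V)) := by
  have H := exists_isFlow_pLam hV e
  rw [hamFlow, dif_pos H]
  exact H.choose_spec

/-- `hamFlow (HPerp e)` is the Hamiltonian flow of `H_Λ^⊥`. -/
theorem isFlow_hamFlow_HPerp (e : Fin 2 → ℤ) :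
    IsFlow (hamField (HPerp e)) (hamFlow (HPerp e)) := by
  have H := exists_isFlow_HPerp e
  rw [hamFlow, dif_pos H]
  exact H.choose_spec

/-- Explicit formula: `φ^t (x, ξ) = (x + t 𝔢_Λ^⊥ / L_Λ, ξ)` for the flow of `H_Λ^⊥`. -/
theorem hamFlow_HPerp (e : Fin 2 → ℤ) (t : ℝ) (z : Phase) :
    hamFlow (HPerp e) t z = (z.1 + proj (t • ((1 / latLen e) • latPerp e)), z.2) := by
  obtain ⟨c, h0, hc⟩ := isFlow_hamFlow_HPerp e z
  let u : Plane × Plane := ((1 / latLen e) • latPerp e, 0)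
  have hd : ∀ t, HasDerivAt (fun t => c t - t • u) 0 t := fun t => by
    have h1 := (hc t).2
    rw [hamField_HPerp] at h1
    have h2 := h1.sub ((hasDerivAt_id t).smul_const u)
    rwa [one_smul, sub_self] at h2
  have h3 := is_const_of_deriv_eq_zero (fun t => (hd t).differentiableAt) (fun t => (hd t).deriv) t 0
  have h4 : c t = (0, z.2) + t • u := by
    rw [← h0, ← sub_eq_iff_eq_add]
    simpa using h3
  rw [(hc t).1, h4]
  simp [u]

end TorusBiinv

end

/-!
On `Crit_Λ(V)` the projected measure is invariant under translations along `𝔢^⊥`, so it is an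
average of the uniform measures on the closed geodesics that project critical orbits: it is a
multiple of an element of `𝒩(Λ)`.

Off `Crit_Λ(V)` the projected measure is absolutely continuous. Along the flow of `p_Λ` the position
moves in the direction `𝔢` with speed `H_Λ`, and `H_Λ` vanishes at a noncritical point of the
trajectory only for a null set of times, because its derivative there is nonzero. Hence the map
`(t, s) ↦ Π (φ^s_{H_Λ^⊥} (φ^t_{p_Λ} z))` is a local diffeomorphism near almost every `(t, s)` whose
image is noncritical, and there it pulls null sets back to null sets. Averaging over `(t, s)` with
the two invariances turns this into absolute continuity.
-/

noncomputable section

namespace TorusBiinv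

section Convexity

variable {X Ω ι : Type*}

theorem sum_smul_mem_of_convex {R E : Type*} [Semifield R] [LinearOrder R] [IsStrictOrderedRing R]
    [AddCommMonoid E] [Module R E] {S : Set E} (hS : Convex R S) {t : Finset ι} {w : ι → R}
    {z : ι → E} (hw : ∀ i ∈ t, 0 ≤ w i) (h1 : ∑ i ∈ t, w i = 1) (hz : ∀ i ∈ t, z i ∈ S) :
    ∑ i ∈ t, w i • z i ∈ S := by
  classical
  induction t using Finset.induction_on generalizing w with
  | empty => simp at h1
  | insert a t ha ih =>
    rw [Finset.forall_mem_insert] at hw hz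
    rw [Finset.sum_insert ha] at h1 ⊢
    rcases (Finset.sum_nonneg hw.2).eq_or_lt' with h0 | h0
    · have hw0 := (Finset.sum_eq_zero_iff_of_nonneg hw.2).1 h0
      have hsum : ∑ i ∈ t, w i • z i = 0 :=
        Finset.sum_eq_zero fun i hi => by rw [hw0 i hi, zero_smul]
      rw [h0, add_zero] at h1
      rw [h1, one_smul, hsum, add_zero]
      exact hz.1
    · have hmem : ∑ i ∈ t, (w i / ∑ j ∈ t, w j) • z i ∈ S :=
        ih (fun i hi => div_nonneg (hw.2 i hi) h0.le)
          (by rw [← Finset.sum_div, div_self h0.ne']) hz.2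
      convert hS hz.1 hmem hw.1 h0.le h1 using 2
      rw [Finset.smul_sum]
      exact Finset.sum_congr rfl fun i _ => by rw [smul_smul, mul_div_cancel₀ _ h0.ne']

theorem integral_sum_smul_finiteMeasure [MeasurableSpace Ω] [TopologicalSpace Ω]
    [OpensMeasurableSpace Ω] (t : Finset ι) (w : ι → ℝ≥0) (m : ι → FiniteMeasure Ω)
    (g : BoundedContinuousFunction Ω ℝ) :
    ∫ x, g x ∂((∑ i ∈ t, w i • m i : FiniteMeasure Ω) : Measure Ω) =
      ∑ i ∈ t, (w i : ℝ) * ∫ x, g x ∂(m i : Measure Ω) := by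
  rw [FiniteMeasure.toMeasure_sum, integral_finsetSum_measure fun i _ => g.integrable _]
  refine Finset.sum_congr rfl fun i _ => ?_
  rw [FiniteMeasure.toMeasure_smul, integral_smul_nnreal_measure, NNReal.smul_def, smul_eq_mul]

theorem integral_comp_simpleFunc {β F : Type*} [MeasurableSpace X] [NormedAddCommGroup F]
    [NormedSpace ℝ F] [CompleteSpace F] (σ : Measure X) [IsFiniteMeasure σ]
    (f : SimpleFunc X β) (h : β → F) :
    ∫ x, h (f x) ∂σ = ∑ y ∈ f.range, σ.real (f ⁻¹' {y}) • h y := by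
  classical
  have hsum : ∀ x, h (f x) = ∑ y ∈ f.range, (f ⁻¹' {y}).indicator (fun _ => h y) x := fun x => by
    rw [Finset.sum_eq_single (f x)]
    · simp
    · exact fun y _ hy => indicator_of_notMem (fun hx : f x = y => hy hx.symm) _
    · exact fun hx => absurd (f.mem_range_self x) hx
  simp only [hsum]
  rw [integral_finsetSum _ fun y _ =>
    (integrable_const (h y)).indicator (f.measurableSet_preimage {y})]
  exact Finset.sum_congr rfl fun y _ => integral_indicator_const _ (f.measurableSet_preimage {y})

variable [MeasurableSpace X] [MeasurableSpace Ω]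

theorem sum_preimage_smul_mem_convexHull (σ : Measure X) [IsProbabilityMeasure σ]
    {S : Set (FiniteMeasure Ω)} (f : SimpleFunc X X) {K : X → FiniteMeasure Ω}
    (hK : ∀ x, K (f x) ∈ S) :
    ∑ y ∈ f.range, (σ (f ⁻¹' {y})).toNNReal • K y ∈ convexHull ℝ≥0 S := by
  refine sum_smul_mem_of_convex (convex_convexHull ℝ≥0 S) (fun _ _ => zero_le) ?_ fun y hy => ?_
  · have h := f.sum_range_measure_preimage_singleton σ
    rw [measure_univ] at h
    rw [← ENNReal.toNNReal_sum fun y _ => measure_ne_top σ _, h, ENNReal.toNNReal_one]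
  · obtain ⟨x, rfl⟩ := SimpleFunc.mem_range.1 hy
    exact subset_convexHull _ _ (hK x)

theorem mem_closure_convexHull_of_integral_eq [PseudoEMetricSpace X] [SecondCountableTopology X]
    [OpensMeasurableSpace X] [TopologicalSpace Ω] [OpensMeasurableSpace Ω] {σ : Measure X}
    [IsProbabilityMeasure σ] {S : Set (FiniteMeasure Ω)} {K : X → FiniteMeasure Ω}
    (hK : Continuous K) {C : ℝ}
    (hC : ∀ x, (K x : Measure Ω).real univ ≤ C) (hS : ∀ᵐ x ∂σ, K x ∈ S) {ν : FiniteMeasure Ω}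
    (hν : ∀ g : BoundedContinuousFunction Ω ℝ,
      ∫ x, (∫ y, g y ∂(K x : Measure Ω)) ∂σ = ∫ y, g y ∂(ν : Measure Ω)) :
    ν ∈ closure (convexHull ℝ≥0 S) := by
  obtain ⟨x₀, hx₀ : x₀ ∈ K ⁻¹' S⟩ := hS.exists
  let f : ℕ → SimpleFunc X X := SimpleFunc.approxOn id measurable_id (K ⁻¹' S) x₀ hx₀
  have hf : ∀ᵐ x ∂σ, Tendsto (fun n => f n x) atTop (𝓝 x) := by
    filter_upwards [hS] with x hx
    exact SimpleFunc.tendsto_approxOn measurable_id hx₀ (subset_closure hx)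
  refine mem_closure_of_tendsto (b := atTop)
    (f := fun n => ∑ y ∈ (f n).range, (σ (f n ⁻¹' {y})).toNNReal • K y) ?_
    (Eventually.of_forall fun n => sum_preimage_smul_mem_convexHull σ (f n)
      fun x => SimpleFunc.approxOn_mem measurable_id hx₀ n x)
  rw [FiniteMeasure.tendsto_iff_forall_integral_tendsto]
  intro g
  have hKg : Continuous fun x => ∫ y, g y ∂(K x : Measure Ω) :=
    continuous_iff_continuousAt.2 fun x =>
      FiniteMeasure.tendsto_iff_forall_integral_tendsto.1 (hK.tendsto x) g
  have hsum : ∀ n, ∫ y, g y ∂((∑ y ∈ (f n).range, (σ (f n ⁻¹' {y})).toNNReal • K y :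
      FiniteMeasure Ω) : Measure Ω) = ∫ x, (∫ y, g y ∂(K (f n x) : Measure Ω)) ∂σ := fun n => by
    rw [integral_sum_smul_finiteMeasure,
      integral_comp_simpleFunc σ (f n) fun y => ∫ y, g y ∂(K y : Measure Ω)]
    rfl
  simp only [hsum]
  rw [← hν g]
  refine tendsto_integral_of_dominated_convergence (fun _ => C * ‖g‖)
    (fun n => (hKg.measurable.comp (f n).measurable).aestronglyMeasurable) (integrable_const _)
    (fun n => Eventually.of_forall fun x => ?_) ?_
  · exact (g.norm_integral_le_mul_norm _).trans
      (mul_le_mul_of_nonneg_right (hC _) (norm_nonneg g))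
  · filter_upwards [hf] with x hx
    exact (hKg.tendsto x).comp hx

end Convexity

section NullSets

theorem measure_eq_zero_iff_ae_ae_notMem {P Z : Type*} [MeasurableSpace P] [MeasurableSpace Z]
    {ν : Measure P} [SFinite ν] [NeZero ν] {μ : Measure Z} [SFinite μ] {Φ : P → Z → Z}
    (hΦ : Measurable (Function.uncurry Φ)) (hμ : ∀ q, MeasurePreserving (Φ q) μ μ) {A : Set Z}
    (hA : MeasurableSet A) : μ A = 0 ↔ ∀ᵐ z ∂μ, ∀ᵐ q ∂ν, Φ q z ∉ A := by
  have hpre : ∀ q, (∀ᵐ z ∂μ, Φ q z ∉ A) ↔ μ A = 0 := fun q => by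
    rw [← (hμ q).measure_preimage hA.nullMeasurableSet]
    exact measure_eq_zero_iff_ae_notMem.symm
  rw [← Measure.ae_ae_comm (p := fun q z => Φ q z ∉ A) (hA.preimage hΦ).compl]
  simp only [hpre, eventually_const]

theorem quasiMeasurePreserving_of_surjective {G H : Type*} [AddGroup G] [AddGroup H]
    [MeasurableSpace G] [MeasurableAdd G] [MeasurableSpace H] [MeasurableAdd₂ H]
    {μ : Measure G} [SFinite μ] [μ.IsAddRightInvariant] {ν : Measure H} [SFinite ν] [NeZero ν]
    [ν.IsAddLeftInvariant] {π : G →+ H} (hπ : Measurable π) (hs : Function.Surjective π) :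
    Measure.QuasiMeasurePreserving π μ ν := by
  refine ⟨hπ, Measure.AbsolutelyContinuous.mk fun N hN hN0 => ?_⟩
  have hae : ∀ᵐ h ∂ν, ∀ᵐ g ∂μ, π g + h ∉ N := by
    rw [← Measure.ae_ae_comm (p := fun g h => π g + h ∉ N)
      (hN.preimage ((hπ.comp measurable_fst).add measurable_snd)).compl]
    refine Eventually.of_forall fun g => measure_eq_zero_iff_ae_notMem.1 ?_
    exact (measure_preimage_add ν (π g) N).trans hN0
  obtain ⟨h, hh⟩ := hae.exists
  obtain ⟨g₀, rfl⟩ := hs h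
  simp only [← map_add] at hh
  rw [Measure.map_apply hπ hN, ← measure_preimage_add_right μ g₀]
  exact measure_eq_zero_iff_ae_notMem.2 hh

section Differentiable

variable {E F : Type*} [NormedAddCommGroup E] [NormedSpace ℝ E] [FiniteDimensional ℝ E]
  [MeasurableSpace E] [BorelSpace E] [NormedAddCommGroup F] [NormedSpace ℝ F]
  [FiniteDimensional ℝ F] [MeasurableSpace F] [BorelSpace F] (μ : Measure E) [μ.IsAddHaarMeasure]
  {ν : Measure F} [ν.IsAddHaarMeasure]

theorem addHaar_image_eq_zero_of_continuousLinearEquiv (A : E ≃L[ℝ] F) {g : F → E} {s : Set F}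
    (hg : DifferentiableOn ℝ g s) (hs : ν s = 0) : μ (g '' s) = 0 := by
  have := A.isAddHaarMeasure_map μ
  have hA : μ (A ⁻¹' s) = 0 := by
    have hmap := Measure.absolutelyContinuous_isAddHaarMeasure (μ.map A) ν hs
    rwa [← A.coe_toHomeomorph, A.toHomeomorph.measurableEmbedding.map_apply] at hmap
  rw [← image_preimage_eq s A.surjective, ← image_comp]
  exact addHaar_image_eq_zero_of_differentiableOn_of_addHaar_eq_zero μ
    (hg.comp A.differentiableOn (mapsTo_preimage A s)) hA

theorem ae_fderiv_isInvertible_imp_notMem {f : E → F} (hf : ContDiff ℝ 1 f) {N : Set F}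
    (hN : ν N = 0) : ∀ᵐ x ∂μ, (fderiv ℝ f x).IsInvertible → f x ∉ N := by
  refine ae_iff.2 (measure_null_of_locally_null _ fun x hx => ?_)
  obtain ⟨⟨A, hA⟩, -⟩ := Classical.not_imp.1 hx
  have hfx : HasFDerivAt f (A : E →L[ℝ] F) x :=
    hA ▸ (hf.differentiable one_ne_zero x).hasFDerivAt
  have hstrict := hf.contDiffAt.hasStrictFDerivAt' hfx one_ne_zero
  let g := hf.contDiffAt.localInverse hfx one_ne_zero
  have hg : ∀ᶠ y in 𝓝 (f x), DifferentiableAt ℝ g y :=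
    ((hf.contDiffAt.to_localInverse hfx one_ne_zero).eventually (by simp)).mono
      fun y hy => hy.differentiableAt one_ne_zero
  refine ⟨g '' {y | y ∈ N ∧ DifferentiableAt ℝ g y}, ?_, ?_⟩
  · refine eventually_nhdsWithin_iff.2 ?_
    filter_upwards [hf.continuous.continuousAt.eventually hg, hstrict.eventually_left_inverse]
      with x' hdiff hinv hx'
    exact ⟨f x', ⟨not_not.1 (Classical.not_imp.1 hx').2, hdiff⟩, hinv⟩
  · exact addHaar_image_eq_zero_of_continuousLinearEquiv μ (ν := ν) A
      (fun y hy => hy.2.differentiableWithinAt) (measure_mono_null (fun y hy => hy.1) hN)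

end Differentiable

theorem ae_eq_imp_deriv_eq_zero {F : Type*} [NormedAddCommGroup F] [NormedSpace ℝ F]
    {y h : ℝ → F} (hy : ∀ t, HasDerivAt y (h t) t) (c : F) : ∀ᵐ t, y t = c → h t = 0 := by
  rw [ae_iff]
  refine measure_null_of_locally_null _ fun t ht => ⟨{t}, ?_, measure_singleton t⟩
  have hne := (hy t).eventually_ne (c := c) (Classical.not_imp.1 ht).2
  refine eventually_nhdsWithin_iff.2 ((eventually_nhdsWithin_iff.1 hne).mono fun s hs hs' => ?_)
  exact by_contra fun hst => hs hst (Classical.not_imp.1 hs').1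

theorem exists_integrable_withDensity_ofReal_eq {X : Type*} [MeasurableSpace X] {ρ ν : Measure X}
    [IsFiniteMeasure ρ] [SigmaFinite ν] (h : ρ ≪ ν) :
    ∃ f : X → ℝ, Integrable f ν ∧ (∀ x, 0 ≤ f x) ∧
      ν.withDensity (fun x => ENNReal.ofReal (f x)) = ρ := by
  refine ⟨fun x => (ρ.rnDeriv ν x).toReal, Measure.integrable_toReal_rnDeriv,
    fun x => ENNReal.toReal_nonneg, ?_⟩
  conv_rhs => rw [← Measure.withDensity_rnDeriv_eq ρ ν h]
  refine withDensity_congr_ae ?_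
  filter_upwards [Measure.rnDeriv_lt_top ρ ν] with x hx
  exact ENNReal.ofReal_toReal hx.ne

end NullSets

section TorusCalculus

theorem isOpenQuotientMap_proj : IsOpenQuotientMap proj := by
  have h : IsOpenQuotientMap (Pi.map fun (_ : Fin 2) (a : ℝ) => (a : UnitAddCircle)) :=
    IsOpenQuotientMap.piMap fun _ => QuotientAddGroup.isOpenQuotientMap_mk
  exact h.comp (EuclideanSpace.equiv (Fin 2) ℝ).toHomeomorph.isOpenQuotientMap

@[fun_prop]
theorem continuous_proj : Continuous proj :=
  isOpenQuotientMap_proj.continuous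

theorem continuous_comp_proj_iff {Y : Type*} [TopologicalSpace Y] {g : Torus → Y} :
    Continuous (fun v => g (proj v)) ↔ Continuous g :=
  isOpenQuotientMap_proj.isQuotientMap.continuous_iff.symm

theorem quasiMeasurePreserving_proj : Measure.QuasiMeasurePreserving proj volume volume :=
  quasiMeasurePreserving_of_surjective (π := AddMonoidHom.mk' proj proj_add)
    continuous_proj.measurable proj_surjective

variable {g : Torus → ℝ}

theorem continuous_torusGrad (hg : ContDiff ℝ 1 fun v => g (proj v)) :
    Continuous (torusGrad g) := by
  rw [← continuous_comp_proj_iff]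
  simp only [torusGrad_proj, gradient]
  exact (InnerProductSpace.toDual ℝ Plane).symm.continuous.comp
    (hg.continuous_fderiv one_ne_zero)

theorem periodic_torusGrad {y : Torus} (hy : Function.Periodic g y) :
    Function.Periodic (torusGrad g) y := fun x => by
  simp only [torusGrad, add_right_comm x y, hy _]

theorem hasGradientAt_torusGrad (hg : Differentiable ℝ fun v => g (proj v)) (x : Torus) :
    HasGradientAt (fun v => g (x + proj v)) (torusGrad g x) 0 := by
  obtain ⟨w, rfl⟩ := proj_surjective x
  simp only [torusGrad, ← proj_add]
  exact (hg.comp (differentiable_id.const_add w) 0).hasGradientAt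

theorem inner_torusGrad_eq_zero (hg : Differentiable ℝ fun v => g (proj v)) {x : Torus}
    {u : Plane} (hu : ∀ t : ℝ, g (x + proj (t • u)) = g x) : ⟪torusGrad g x, u⟫ = 0 := by
  have hline : HasDerivAt (fun t : ℝ => t • u) u 0 := by
    simpa using (hasDerivAt_id (0 : ℝ)).smul_const u
  have hg' := (hasGradientAt_torusGrad hg x).hasFDerivAt
  rw [← zero_smul ℝ u] at hg'
  have hconst : HasDerivAt (fun t : ℝ => g (x + proj (t • u))) 0 0 := by
    simpa only [hu] using hasDerivAt_const (0 : ℝ) (g x)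
  have hcomp := hg'.comp_hasDerivAt (0 : ℝ) hline
  exact hcomp.unique hconst

theorem exists_torusGrad_eq_zero (hg : Continuous g) : ∃ x, torusGrad g x = 0 := by
  obtain ⟨x, -, hx⟩ := isCompact_univ.exists_isMaxOn univ_nonempty hg.continuousOn
  have hmax : IsLocalMax (fun v : Plane => g (x + proj v)) 0 :=
    Eventually.of_forall fun v => by
      have h0 : proj 0 = 0 := (AddMonoidHom.mk' proj proj_add).map_zero
      simpa only [h0, add_zero] using mem_ofPred.1 (hx (mem_univ (x + proj v)))
  exact ⟨x, by rw [torusGrad, gradient, hmax.fderiv_eq_zero, map_zero]⟩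

end TorusCalculus

section Frame

/-- The unit vector `𝔢 / ‖𝔢‖`; it is `0` for `𝔢 = 0`. -/
def unitVec (e : Fin 2 → ℤ) : Plane := (1 / latLen e) • latVec e

/-- The unit vector `𝔢^⊥ / ‖𝔢‖`; it is `0` for `𝔢 = 0`. -/
def unitPerp (e : Fin 2 → ℤ) : Plane := (1 / latLen e) • latPerp e

theorem latLen_sq (e : Fin 2 → ℤ) : latLen e ^ 2 = (e 0 : ℝ) ^ 2 + (e 1 : ℝ) ^ 2 := by
  simp [latLen, EuclideanSpace.norm_sq_eq, latVec]

theorem latLen_pos {e : Fin 2 → ℤ} (he : e ≠ 0) : 0 < latLen e := by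
  refine norm_pos_iff.2 fun h => he ?_
  ext i
  have hi := congrArg (fun v : Plane => v i) h
  fin_cases i <;> simpa [latVec] using hi

theorem inner_unitPerp_unitVec (e : Fin 2 → ℤ) : ⟪unitPerp e, unitVec e⟫ = 0 := by
  simp only [unitVec, unitPerp, latVec, latPerp, inner_smul_left, inner_smul_right,
    PiLp.inner_apply, Fin.sum_univ_two]
  simp [mul_comm]

theorem norm_unitVec {e : Fin 2 → ℤ} (he : e ≠ 0) : ‖unitVec e‖ = 1 := by
  have hL := latLen_pos he
  rw [unitVec, norm_smul, ← latLen, Real.norm_of_nonneg (by positivity),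
    one_div_mul_cancel hL.ne']

theorem norm_latPerp (e : Fin 2 → ℤ) : ‖latPerp e‖ = latLen e := by
  simp [latLen, EuclideanSpace.norm_eq, latPerp, latVec, add_comm]

theorem norm_unitPerp {e : Fin 2 → ℤ} (he : e ≠ 0) : ‖unitPerp e‖ = 1 := by
  have hL := latLen_pos he
  rw [unitPerp, norm_smul, norm_latPerp, Real.norm_of_nonneg (by positivity),
    one_div_mul_cancel hL.ne']

theorem inner_smul_unitVec_add_inner_smul_unitPerp {e : Fin 2 → ℤ} (he : e ≠ 0) (w : Plane) :
    ⟪w, unitVec e⟫ • unitVec e + ⟪w, unitPerp e⟫ • unitPerp e = w := by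
  have hL := (latLen_pos he).ne'
  ext i
  fin_cases i <;>
    simp only [unitVec, unitPerp, latVec, latPerp, inner_smul_right, PiLp.inner_apply,
      RCLike.inner_apply, Real.ringHom_apply, Fin.sum_univ_two, Matrix.cons_val_zero,
      Matrix.cons_val_one, Matrix.cons_val_fin_one, Fin.zero_eta, Fin.mk_one, PiLp.add_apply,
      PiLp.smul_apply, smul_eq_mul] <;>
    field_simp <;> rw [latLen_sq] <;> ring

theorem HLam_eq_inner (e : Fin 2 → ℤ) (z : Phase) : HLam e z = ⟪z.2, unitVec e⟫ :=
  (inner_smul_right _ _ _).symm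

end Frame

section PerpShift

/-- The translation `x ↦ x + s 𝔢^⊥ / ‖𝔢‖` of the torus. -/
def perpShift (e : Fin 2 → ℤ) (s : ℝ) (x : Torus) : Torus := x + proj (s • unitPerp e)

theorem hamFlow_HPerp_eq_perpShift (e : Fin 2 → ℤ) (s : ℝ) (z : Phase) :
    hamFlow (HPerp e) s z = (perpShift e s z.1, z.2) :=
  hamFlow_HPerp e s z

@[fun_prop]
theorem continuous_perpShift (e : Fin 2 → ℤ) {Y : Type*} [TopologicalSpace Y] {s : Y → ℝ}
    {x : Y → Torus} (hs : Continuous s) (hx : Continuous x) :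
    Continuous fun y => perpShift e (s y) (x y) := by
  unfold perpShift
  fun_prop

theorem perpShift_perpShift (e : Fin 2 → ℤ) (s t : ℝ) (x : Torus) :
    perpShift e s (perpShift e t x) = perpShift e (t + s) x := by
  simp only [perpShift, add_smul, proj_add, add_assoc]

theorem proj_latPerp (e : Fin 2 → ℤ) : proj (latPerp e) = 0 := by
  ext i
  fin_cases i
  · exact (AddCircle.coe_eq_zero_iff (1 : ℝ)).2 ⟨-e 1, by simp [latPerp]⟩
  · exact (AddCircle.coe_eq_zero_iff (1 : ℝ)).2 ⟨e 0, by simp [latPerp]⟩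

theorem periodic_perpShift {e : Fin 2 → ℤ} (he : e ≠ 0) (x : Torus) :
    Function.Periodic (fun s => perpShift e s x) (latLen e) := fun s => by
  have h : latLen e • unitPerp e = latPerp e := by
    rw [unitPerp, smul_smul, mul_one_div_cancel (latLen_pos he).ne', one_smul]
  simp only [perpShift, add_smul, proj_add, h, proj_latPerp, add_zero]

end PerpShift

section Average

variable {e : Fin 2 → ℤ} {V : Torus → ℝ}

theorem avg_eq_integral_perpShift (e : Fin 2 → ℤ) (V : Torus → ℝ) (x : Torus) :
    avg e V x = (1 / latLen e) * ∫ s in (0 : ℝ)..latLen e, V (perpShift e s x) := by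
  simp only [avg, perpShift, unitPerp, smul_smul, mul_one_div]

theorem contDiff_avg_proj {n : ℕ} (hV : ContDiff ℝ n fun v => V (proj v)) (e : Fin 2 → ℤ) :
    ContDiff ℝ n fun v => avg e V (proj v) := by
  simp only [avg_eq_integral_perpShift, perpShift, ← proj_add]
  exact contDiff_const.mul (contDiff_lineAvg n hV (unitPerp e) (latLen e))

theorem avg_perpShift (he : e ≠ 0) (V : Torus → ℝ) (t : ℝ) (x : Torus) :
    avg e V (perpShift e t x) = avg e V x := by
  have h := ((periodic_perpShift he x).comp V).intervalIntegral_add_eq t 0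
  simp only [avg_eq_integral_perpShift, perpShift_perpShift]
  rw [intervalIntegral.integral_comp_add_left fun s => V (perpShift e s x), add_zero]
  rw [zero_add] at h
  exact congrArg _ h

theorem torusGrad_avg_perpShift (he : e ≠ 0) (V : Torus → ℝ) (t : ℝ) (x : Torus) :
    torusGrad (avg e V) (perpShift e t x) = torusGrad (avg e V) x :=
  periodic_torusGrad (avg_perpShift he V t) x

theorem inner_torusGrad_avg_unitPerp (he : e ≠ 0) (hV : Differentiable ℝ fun v => avg e V (proj v))
    (x : Torus) : ⟪torusGrad (avg e V) x, unitPerp e⟫ = 0 :=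
  inner_torusGrad_eq_zero hV fun t => avg_perpShift he V t x

theorem torusGrad_avg_eq_zero_of_inner_unitVec_eq_zero (he : e ≠ 0)
    (hV : Differentiable ℝ fun v => avg e V (proj v)) {x : Torus}
    (h : ⟪torusGrad (avg e V) x, unitVec e⟫ = 0) : torusGrad (avg e V) x = 0 := by
  rw [← inner_smul_unitVec_add_inner_smul_unitPerp he (torusGrad (avg e V) x), h,
    inner_torusGrad_avg_unitPerp he hV, zero_smul, zero_smul, add_zero]

theorem integral_avg (he : e ≠ 0) {σ : Measure Torus} [IsFiniteMeasure σ]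
    (hσ : ∀ s, MeasurePreserving (perpShift e s) σ σ) {g : Torus → ℝ} (hg : Continuous g) :
    ∫ x, avg e g x ∂σ = ∫ x, g x ∂σ := by
  have hL := latLen_pos he
  obtain ⟨M, hM⟩ := isCompact_univ.exists_bound_of_continuousOn hg.continuousOn
  have hint : Integrable (Function.uncurry fun x s => g (perpShift e s x))
      (σ.prod (volume.restrict (Ioc 0 (latLen e)))) :=
    Integrable.of_bound (Continuous.aestronglyMeasurable (by fun_prop)) M
      (Eventually.of_forall fun q => hM _ (mem_univ _))
  have hs : ∀ s, ∫ x, g (perpShift e s x) ∂σ = ∫ x, g x ∂σ := fun s => by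
    conv_rhs => rw [← (hσ s).map_eq]
    exact (integral_map (hσ s).measurable.aemeasurable hg.aestronglyMeasurable).symm
  calc ∫ x, avg e g x ∂σ
      = (1 / latLen e) * ∫ x, (∫ s in Ioc 0 (latLen e), g (perpShift e s x)) ∂σ := by
        simp only [avg_eq_integral_perpShift, intervalIntegral.integral_of_le hL.le]
        rw [integral_const_mul]
    _ = (1 / latLen e) * ∫ _ in Ioc 0 (latLen e), (∫ x, g x ∂σ) := by
        rw [integral_integral_swap hint]
        simp only [hs]
    _ = ∫ x, g x ∂σ := by
        rw [setIntegral_const, smul_eq_mul, Real.volume_real_Ioc_of_le hL.le, sub_zero,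
          ← mul_assoc, one_div_mul_cancel hL.ne', one_mul]

end Average

section Critical

variable {e : Fin 2 → ℤ} {V : Torus → ℝ}

theorem isClosed_Crit (hV : ContDiff ℝ 1 fun v => avg e V (proj v)) : IsClosed (Crit e V) := by
  have hH : Continuous (HLam e) := by
    unfold HLam
    fun_prop
  exact (isClosed_singleton.preimage hH).inter
    (isClosed_singleton.preimage ((continuous_torusGrad hV).comp continuous_fst))

theorem hamFlow_HPerp_mem_Crit_iff (he : e ≠ 0) {s : ℝ} {z : Phase} :
    hamFlow (HPerp e) s z ∈ Crit e V ↔ z ∈ Crit e V := by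
  simp only [Crit, mem_ofPred_eq, hamFlow_HPerp_eq_perpShift, torusGrad_avg_perpShift he, HLam]

end Critical

section SingularPart

variable {e : Fin 2 → ℤ} {V : Torus → ℝ}

instance isZeroOrProbabilityMeasure_orbitMeasure (e : Fin 2 → ℤ) (z : Phase) :
    IsZeroOrProbabilityMeasure (orbitMeasure e z) := by
  refine ⟨?_⟩
  have hm : Measurable fun s => perpShift e s z.1 := Continuous.measurable (by fun_prop)
  simp only [orbitMeasure, hamFlow_HPerp_eq_perpShift, Measure.smul_apply,
    Measure.map_apply hm MeasurableSet.univ, preimage_univ, Measure.restrict_apply_univ,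
    Real.volume_Ioc, sub_zero, smul_eq_mul]
  rcases eq_or_ne (ENNReal.ofReal (latLen e)) 0 with h | h
  · exact Or.inl (by rw [h, mul_zero])
  · exact Or.inr (ENNReal.inv_mul_cancel h ENNReal.ofReal_ne_top)

/-- The measure `δ_{Π∘Γ}` of the orbit `Γ` of `(x, ξ)`, as a finite measure; it does not depend on
`ξ`, so only the orbit of `(x, 0)` is considered. -/
def geodesicMeasure (e : Fin 2 → ℤ) (x : Torus) : FiniteMeasure Torus :=
  ⟨orbitMeasure e (x, 0), inferInstance⟩

theorem integral_geodesicMeasure (e : Fin 2 → ℤ) (x : Torus) {g : Torus → ℝ} (hg : Continuous g) :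
    ∫ y, g y ∂(geodesicMeasure e x : Measure Torus) = avg e g x := by
  have hL : 0 ≤ latLen e := norm_nonneg _
  have hm : Continuous fun s => perpShift e s x := by fun_prop
  simp only [geodesicMeasure, FiniteMeasure.toMeasure_mk, orbitMeasure, hamFlow_HPerp_eq_perpShift]
  rw [integral_smul_measure, integral_map hm.aemeasurable hg.aestronglyMeasurable,
    avg_eq_integral_perpShift, intervalIntegral.integral_of_le hL, ENNReal.toReal_inv,
    ENNReal.toReal_ofReal hL, smul_eq_mul, one_div]

theorem continuous_geodesicMeasure (e : Fin 2 → ℤ) : Continuous (geodesicMeasure e) := by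
  refine continuous_iff_continuousAt.2 fun x =>
    FiniteMeasure.tendsto_iff_forall_integral_tendsto.2 fun g => ?_
  simp only [integral_geodesicMeasure e _ g.continuous]
  have hg : Continuous (avg e g) := continuous_comp_proj_iff.1 <|
    (contDiff_avg_proj (n := 0) (contDiff_zero.2 (g.continuous.comp continuous_proj)) e).continuous
  exact hg.tendsto x

/-- The measures `δ_{Π∘Γ}` of the orbits `Γ` contained in the critical set, whose closed convex hull
is `𝒩(Λ)`. -/
def criticalOrbitMeasures (e : Fin 2 → ℤ) (V : Torus → ℝ) : Set (FiniteMeasure Torus) :=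
  {m | ∃ z : Phase, (∀ s : ℝ, hamFlow (HPerp e) s z ∈ Crit e V) ∧
    (m : Measure Torus) = orbitMeasure e z}

theorem NLam_eq_closure_convexHull (e : Fin 2 → ℤ) (V : Torus → ℝ) :
    NLam e V = closure (convexHull ℝ≥0 (criticalOrbitMeasures e V)) :=
  rfl

theorem geodesicMeasure_mem_criticalOrbitMeasures (he : e ≠ 0) {x : Torus}
    (hx : torusGrad (avg e V) x = 0) : geodesicMeasure e x ∈ criticalOrbitMeasures e V :=
  ⟨(x, 0), fun _ => (hamFlow_HPerp_mem_Crit_iff he).2 ⟨by simp [HLam], hx⟩, rfl⟩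

theorem nonempty_NLam (he : e ≠ 0) (hV : Continuous (avg e V)) : (NLam e V).Nonempty := by
  obtain ⟨x, hx⟩ := exists_torusGrad_eq_zero hV
  rw [NLam_eq_closure_convexHull]
  exact ⟨_, subset_closure
    (subset_convexHull ℝ≥0 _ (geodesicMeasure_mem_criticalOrbitMeasures he hx))⟩

theorem mem_NLam_of_measurePreserving_perpShift (he : e ≠ 0) (σ : Measure Torus)
    [IsProbabilityMeasure σ] (hσ : ∀ s, MeasurePreserving (perpShift e s) σ σ)
    (hC : ∀ᵐ x ∂σ, torusGrad (avg e V) x = 0) :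
    (⟨σ, inferInstance⟩ : FiniteMeasure Torus) ∈ NLam e V := by
  rw [NLam_eq_closure_convexHull]
  refine mem_closure_convexHull_of_integral_eq (continuous_geodesicMeasure e)
    (fun x => measureReal_le_one (μ := orbitMeasure e (x, 0)))
    (hC.mono fun x hx => geodesicMeasure_mem_criticalOrbitMeasures he hx) fun g => ?_
  simp only [integral_geodesicMeasure e _ g.continuous]
  exact integral_avg he hσ g.continuous

theorem exists_mem_NLam_map_fst_eq (he : e ≠ 0) (hV : ContDiff ℝ 1 fun v => avg e V (proj v))
    (μ : Measure Phase) [IsProbabilityMeasure μ]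
    (hμ : ∀ s, MeasurePreserving (hamFlow (HPerp e) s) μ μ) (hC : ∀ᵐ z ∂μ, z ∈ Crit e V) :
    ∃ ν ∈ NLam e V, μ.map Prod.fst = (ν : Measure Torus) := by
  have hfst := measurable_fst.measurePreserving (α := Phase) μ
  have := Measure.isProbabilityMeasure_map (μ := μ) measurable_fst.aemeasurable (f := Prod.fst)
  refine ⟨_, mem_NLam_of_measurePreserving_perpShift he (μ.map Prod.fst) (fun s => ?_) ?_, rfl⟩
  · exact hfst.of_semiconj (hμ s) (fun z => by rw [hamFlow_HPerp_eq_perpShift])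
      (continuous_perpShift e continuous_const continuous_id).measurable
  · exact (ae_map_iff measurable_fst.aemeasurable
      (isClosed_singleton.preimage (continuous_torusGrad hV)).measurableSet).2
      (hC.mono fun z hz => hz.2)

theorem exists_mem_NLam_map_fst_restrict_Crit_eq (he : e ≠ 0)
    (hV : ContDiff ℝ 1 fun v => avg e V (proj v)) (μ : Measure Phase) [IsFiniteMeasure μ]
    (hμ : ∀ s, MeasurePreserving (hamFlow (HPerp e) s) μ μ) :
    ∃ ν ∈ NLam e V, (μ.restrict (Crit e V)).map Prod.fst = μ (Crit e V) • (ν : Measure Torus) := by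
  have hC : MeasurableSet (Crit e V) := (isClosed_Crit hV).measurableSet
  rcases eq_or_ne (μ (Crit e V)) 0 with h0 | h0
  · obtain ⟨ν, hν⟩ := nonempty_NLam he (continuous_comp_proj_iff.1 hV.continuous)
    exact ⟨ν, hν, by rw [Measure.restrict_eq_zero.2 h0, Measure.map_zero, h0, zero_smul]⟩
  have := ProbabilityTheory.cond_isProbabilityMeasure h0
  have hinv : ∀ s, MeasurePreserving (hamFlow (HPerp e) s)
      (ProbabilityTheory.cond μ (Crit e V)) (ProbabilityTheory.cond μ (Crit e V)) := fun s => by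
    have hpre : hamFlow (HPerp e) s ⁻¹' Crit e V = Crit e V :=
      Set.ext fun z => hamFlow_HPerp_mem_Crit_iff he
    have hs := (hμ s).restrict_preimage hC
    rw [hpre] at hs
    exact hs.smul_measure _
  obtain ⟨ν, hν, h⟩ :=
    exists_mem_NLam_map_fst_eq he hV _ hinv (ProbabilityTheory.ae_cond_mem hC)
  refine ⟨ν, hν, ?_⟩
  rw [← h, ProbabilityTheory.cond, Measure.map_smul, smul_smul,
    ENNReal.mul_inv_cancel h0 (measure_ne_top μ _), one_smul]

end SingularPart

section AbsolutelyContinuousPart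

variable {e : Fin 2 → ℤ} {V : Torus → ℝ} {φ : ℝ → Phase → Phase}

theorem IsFlow.continuous_orbit {X : Phase → Plane × Plane} (hφ : IsFlow X φ) (z : Phase) :
    Continuous fun t => φ t z := by
  obtain ⟨c, -, hc⟩ := hφ z
  have hcc : Continuous c := continuous_iff_continuousAt.2 fun t => (hc t).2.continuousAt
  simp only [fun t => (hc t).1]
  fun_prop

theorem IsFlow.exists_lift_position (hφ : IsFlow (hamField (pLam e V)) φ) (z : Phase) :
    ∃ c : ℝ → Plane, ∀ t, (φ t z).1 = z.1 + proj (c t) ∧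
      HasDerivAt c (HLam e (φ t z) • unitVec e) t := by
  obtain ⟨c, -, hc⟩ := hφ z
  refine ⟨fun t => (c t).1, fun t => ⟨by rw [(hc t).1], ?_⟩⟩
  have hd := (hasFDerivAt_fst (𝕜 := ℝ) (p := c t)).comp_hasDerivAt t (hc t).2
  rw [hamField_pLam] at hd
  refine hd.congr_deriv ?_
  rw [unitVec, smul_smul, mul_one_div]
  rfl

theorem IsFlow.hasDerivAt_HLam (hφ : IsFlow (hamField (pLam e V)) φ) (z : Phase) (t : ℝ) :
    HasDerivAt (fun t => HLam e (φ t z)) (-⟪torusGrad (avg e V) (φ t z).1, unitVec e⟫) t := by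
  obtain ⟨c, -, hc⟩ := hφ z
  have hd := (hasFDerivAt_snd (𝕜 := ℝ) (p := c t)).comp_hasDerivAt t (hc t).2
  rw [hamField_pLam] at hd
  have hinner := (hasFDerivAt_inner_right (unitVec e) (c t).2).comp_hasDerivAt t hd
  have hHLam : (fun t => HLam e (φ t z)) = fun t => ⟪(c t).2, unitVec e⟫ :=
    funext fun t => by rw [HLam_eq_inner, (hc t).1]
  rw [hHLam]
  refine hinner.congr_deriv ?_
  simp [real_inner_comm]

theorem IsFlow.ae_HLam_eq_zero_imp_mem_Crit (he : e ≠ 0)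
    (hV : Differentiable ℝ fun v => avg e V (proj v))
    (hφ : IsFlow (hamField (pLam e V)) φ) (z : Phase) :
    ∀ᵐ t, HLam e (φ t z) = 0 → φ t z ∈ Crit e V := by
  filter_upwards [ae_eq_imp_deriv_eq_zero (hφ.hasDerivAt_HLam z) 0] with t ht h0
  exact ⟨h0, torusGrad_avg_eq_zero_of_inner_unitVec_eq_zero he hV (neg_eq_zero.1 (ht h0))⟩

theorem isInvertible_fderiv_add_smul_unitPerp (he : e ≠ 0) {c : ℝ → Plane} {h : ℝ} {q : ℝ × ℝ}
    (hc : HasDerivAt c (h • unitVec e) q.1) (hh : h ≠ 0) :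
    (fderiv ℝ (fun q : ℝ × ℝ => c q.1 + q.2 • unitPerp e) q).IsInvertible := by
  have hf : HasFDerivAt (fun q : ℝ × ℝ => c q.1 + q.2 • unitPerp e)
      ((ContinuousLinearMap.fst ℝ ℝ ℝ).smulRight (h • unitVec e) +
        (ContinuousLinearMap.snd ℝ ℝ ℝ).smulRight (unitPerp e)) q := by
    refine ((hc.hasFDerivAt.comp q hasFDerivAt_fst).add
      (hasFDerivAt_snd.smul_const (unitPerp e))).congr_fderiv ?_
    ext <;> simp
  rw [hf.fderiv]
  refine ContinuousLinearMap.IsInvertible.of_inverse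
    (g := (h⁻¹ • innerSL ℝ (unitVec e)).prod (innerSL ℝ (unitPerp e))) ?_ ?_
  · ext1 w
    have hw := inner_smul_unitVec_add_inner_smul_unitPerp he w
    simpa [real_inner_comm, smul_smul, inv_mul_cancel₀ hh, mul_right_comm] using hw
  · ext <;> simp [norm_unitVec he, norm_unitPerp he, inner_unitPerp_unitVec, real_inner_comm, hh]

theorem IsFlow.ae_HLam_ne_zero_imp_perpShift_notMem (he : e ≠ 0)
    (hφ : IsFlow (hamField (pLam e V)) φ) (z : Phase) {N : Set Torus} (hN : volume N = 0) :
    ∀ᵐ q : ℝ × ℝ, HLam e (φ q.1 z) ≠ 0 → perpShift e q.2 (φ q.1 z).1 ∉ N := by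
  obtain ⟨c, hc⟩ := hφ.exists_lift_position z
  have hc1 : ContDiff ℝ 1 c := by
    refine contDiff_one_iff_deriv.2 ⟨fun t => (hc t).2.differentiableAt, ?_⟩
    rw [show deriv c = _ from funext fun t => (hc t).2.deriv]
    have hH : Continuous fun t => HLam e (φ t z) :=
      continuous_iff_continuousAt.2 fun t => (hφ.hasDerivAt_HLam z t).continuousAt
    fun_prop
  have hπ : Measure.QuasiMeasurePreserving (fun v => z.1 + proj v) volume volume :=
    (measurePreserving_add_left volume z.1).quasiMeasurePreserving.comp quasiMeasurePreserving_proj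
  have hf : ContDiff ℝ 1 fun q : ℝ × ℝ => c q.1 + q.2 • unitPerp e := by fun_prop
  filter_upwards [ae_fderiv_isInvertible_imp_notMem volume hf (hπ.preimage_null hN)] with q hq hH
  have hqN := hq (isInvertible_fderiv_add_smul_unitPerp he (hc q.1).2 hH)
  rwa [mem_preimage, proj_add, ← add_assoc, ← (hc q.1).1] at hqN

theorem absolutelyContinuous_map_fst_restrict_compl_Crit (he : e ≠ 0)
    (hV : ContDiff ℝ 1 fun v => avg e V (proj v)) (hφ : IsFlow (hamField (pLam e V)) φ)
    (μ : Measure Phase) [SFinite μ] (hμH : ∀ t, MeasurePreserving (hamFlow (HPerp e) t) μ μ)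
    (hμp : ∀ t, MeasurePreserving (φ t) μ μ) :
    (μ.restrict (Crit e V)ᶜ).map Prod.fst ≪ volume := by
  refine Measure.AbsolutelyContinuous.mk fun N hN hN0 => ?_
  have hC : MeasurableSet (Crit e V) := (isClosed_Crit hV).measurableSet
  have hA : MeasurableSet (Prod.fst ⁻¹' N ∩ (Crit e V)ᶜ : Set Phase) :=
    (hN.preimage measurable_fst).inter hC.compl
  have hΦ : Measurable (Function.uncurry fun (q : ℝ × ℝ) z => hamFlow (HPerp e) q.2 (φ q.1 z)) := by
    have hp : Measurable (Function.uncurry φ) :=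
      measurable_uncurry_of_continuous_of_measurable hφ.continuous_orbit fun t => (hμp t).measurable
    have hH : Measurable (Function.uncurry (hamFlow (HPerp e))) := by
      simp only [Function.uncurry_def, hamFlow_HPerp_eq_perpShift]
      exact Continuous.measurable (by fun_prop)
    exact hH.comp (measurable_fst.snd.prodMk (hp.comp (measurable_fst.fst.prodMk measurable_snd)))
  rw [Measure.map_apply measurable_fst hN, Measure.restrict_apply (hN.preimage measurable_fst),
    measure_eq_zero_iff_ae_ae_notMem (ν := volume) hΦ (fun q => (hμH q.2).comp (hμp q.1)) hA]
  refine Eventually.of_forall fun z => ?_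
  have hcrit : ∀ᵐ q : ℝ × ℝ, HLam e (φ q.1 z) = 0 → φ q.1 z ∈ Crit e V :=
    Measure.quasiMeasurePreserving_fst.ae
      (hφ.ae_HLam_eq_zero_imp_mem_Crit he (hV.differentiable one_ne_zero) z)
  filter_upwards [hφ.ae_HLam_ne_zero_imp_perpShift_notMem he z hN0, hcrit] with q hne h0
  rintro ⟨hqN, hqC⟩
  rw [mem_compl_iff, hamFlow_HPerp_mem_Crit_iff he] at hqC
  rw [mem_preimage, hamFlow_HPerp_eq_perpShift] at hqN
  exact hne (fun h => hqC (h0 h)) hqN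

end AbsolutelyContinuousPart

theorem IsPrimitiveRankOne.ne_zero_of_zmultiples_eq {Λ : AddSubgroup (Fin 2 → ℤ)}
    (hΛ : IsPrimitiveRankOne Λ) {e : Fin 2 → ℤ} (he : AddSubgroup.zmultiples e = Λ) : e ≠ 0 := by
  rintro rfl
  have h0 : latVec 0 = 0 := by
    ext i
    fin_cases i <;> simp [latVec]
  have hspan : Submodule.span ℝ (latVec '' (Λ : Set (Fin 2 → ℤ))) = ⊥ := by
    rw [← he, AddSubgroup.zmultiples_zero_eq_bot, AddSubgroup.coe_bot, image_singleton, h0,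
      Submodule.span_zero_singleton]
  have hrank := hΛ.1
  rw [hspan, finrank_bot] at hrank
  exact zero_ne_one hrank

end TorusBiinv

end

open TorusBiinv in
theorem corollaryA3_general {V : Torus → ℝ} (hV : ContDiff ℝ 1 fun v : Plane => V (proj v))
    {e : Fin 2 → ℤ} (he : e ≠ 0) {φ : ℝ → Phase → Phase} (hφ : IsFlow (hamField (pLam e V)) φ)
    (μ : Measure Phase) [IsProbabilityMeasure μ]
    (hμH : ∀ t : ℝ, MeasurePreserving (hamFlow (HPerp e) t) μ μ)
    (hμp : ∀ t : ℝ, MeasurePreserving (φ t) μ μ) :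
    ∃ (f : Torus → ℝ) (α : ℝ) (νsing : FiniteMeasure Torus),
      Integrable f volume ∧ (∀ x, 0 ≤ f x) ∧ α ∈ Icc (0 : ℝ) 1 ∧ νsing ∈ NLam e V ∧
      μ.map Prod.fst =
        volume.withDensity (fun x => ENNReal.ofReal (f x)) +
          ENNReal.ofReal α • (νsing : Measure Torus) := by
  have hI : ContDiff ℝ 1 fun v => avg e V (proj v) := contDiff_avg_proj (n := 1) hV e
  have hC : MeasurableSet (Crit e V) := (isClosed_Crit hI).measurableSet
  obtain ⟨ν, hν, hsing⟩ := exists_mem_NLam_map_fst_restrict_Crit_eq he hI μ hμH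
  obtain ⟨f, hf, hf0, hac⟩ := exists_integrable_withDensity_ofReal_eq
    (absolutelyContinuous_map_fst_restrict_compl_Crit he hI hφ μ hμH hμp)
  refine ⟨f, μ.real (Crit e V), ν, hf, hf0, ⟨measureReal_nonneg, measureReal_le_one⟩, hν, ?_⟩
  rw [hac, ofReal_measureReal, ← hsing, ← Measure.map_add _ _ measurable_fst, add_comm,
    Measure.restrict_add_restrict_compl hC]

open TorusBiinv in
theorem corollaryA3 (V : Torus → ℝ) (hV : SmoothOnTorus V)
    (Λ : AddSubgroup (Fin 2 → ℤ)) (hΛ : IsPrimitiveRankOne Λ)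
    (e : Fin 2 → ℤ) (he : AddSubgroup.zmultiples e = Λ)
    (μ : Measure Phase) [IsProbabilityMeasure μ]
    (hμH : ∀ t : ℝ, MeasurePreserving (hamFlow (HPerp e) t) μ μ)
    (hμp : ∀ t : ℝ, MeasurePreserving (hamFlow (pLam e V) t) μ μ) :
    ∃ (f : Torus → ℝ) (α : ℝ) (νsing : FiniteMeasure Torus),
      Integrable f volume ∧ (∀ x, 0 ≤ f x) ∧ α ∈ Icc (0 : ℝ) 1 ∧ νsing ∈ NLam e V ∧
      μ.map Prod.fst =
        volume.withDensity (fun x => ENNReal.ofReal (f x)) +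
          ENNReal.ofReal α • (νsing : Measure Torus) :=
  corollaryA3_general (contDiff_infty.1 hV 1) (hΛ.ne_zero_of_zmultiples_eq he)
    (isFlow_hamFlow_pLam hV e) μ hμH hμp
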